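/- Let $\mathbb{A}=(a_{ij})_{i,j\in I}$ be a symmetrizable generalized Cartan matrix indexed by a finite set $I$ and let $(I,\mathbb{A},\Lambda,(c_i)_{i\in I},(h_i)_{i\in I})$ be a free and cofree Kac-Moody root datum: $\Lambda$ is a free $\mathbb{Z}$-module of finite rank, $(c_i)_{i\in I}\subset\Lambda$ and $(h_i)_{i\in I}\subset\Lambda^\vee=\operatorname{Hom}(\Lambda,\mathbb{Z})$ are linearly independent families, and $\langle c_j,h_i\rangle=a_{ij}$ for all $i,j\in I$. Put $\mathfrak{a}:=\Lambda^\vee\otimes_{\mathbb{Z}}\mathbb{R}$, let $\alpha_i\in\mathfrak{a}^*$ be the functional defined by $c_i$, and let $\alpha_i^\vee:=h_i\in\mathfrak{a}$. Let $W$ be the group generated by $S=\{s_i\mid i\in I\}$ subject to the relations $(s_is_j)^{m_{ij}}=1$, where $m_{ii}=1$ and, for $i\neq j$, $m_{ij}=2,3,4,6$ or $\infty$ (no relation) according to whether $a_{ij}a_{ji}=0,1,2,3$ or $\geq 4$. It acts linearly on $\mathfrak{a}$ by $s_i(x)=x-\langle\alpha_i,x\rangle\alpha_i^\vee$. For $J\subset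 I$ let $W_J:=\langle s_j\mid j\in J\rangle$. The left cosets $wW_J\subset W$ with $w\in W$ and $J\subset I$ are called standard cosets, and $\Sigma^*(W,S)$ denotes the set of all standard cosets (as subsets of $W$), ordered by inclusion. A face of a convex set $P$ is a non-empty convex subset $F\subset P$ such that $[p_1,p_2]\subset F$ whenever $p_1,p_2\in P$ and the open segment $(p_1,p_2)$ meets $F$. The dimension of a face is the dimension of its affine span. Let $h\in C:=\{x\in\mathfrak{a}\mid\langle\alpha_i,x\rangle>0\text{ for all }i\in I\}$, and put $\Xi_h:=\operatorname{conv}(W\cdot h)$ and $F_J:=\operatorname{conv}(W_J\cdot h)$ for $J\subset I$. Then for all $w\in W$ and $J\subset I$, the set $w(F_J)=\operatorname{conv}(wW_J\cdot h)$ is a face of $\Xi_h$ of dimension $|J|$. Conversely, for every face $F$ of $\Xi_h$ there is a unique standard coset $X$ such that $F=\operatorname{conv}(X\cdot h)$. Hence the map $X\mapsto\operatorname{conv}(X\cdot h)$ is a bijection from the set of standard cosets of $(W,S)$ onto the set of faces of $\Xi_h$, and it is an isomorphism of posets from $\Sigma^*(W,S)$ onto the poset of faces of $\Xi_h$ ordered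 by inclusion. -/

import Mathlib

open scoped TensorProduct Pointwise

/-- A generalized Cartan matrix indexed by `I`. -/
structure IsGeneralizedCartanMatrix {I : Type*} (A : Matrix I I ℤ) : Prop where
  diag : ∀ i, A i i = 2
  offDiag_nonpos : ∀ i j, i ≠ j → A i j ≤ 0
  eq_zero_iff : ∀ i j, A i j = 0 ↔ A j i = 0

/-- `A` is symmetrizable: `A = D * B` with `D` diagonal and `B` symmetric. -/
def IsSymmetrizable {I : Type*} [Fintype I] [DecidableEq I] (A : Matrix I I ℤ) : Prop :=
  ∃ (d : I → ℝ) (B : Matrix I I ℝ), B.IsSymm ∧ A.map (Int.cast : ℤ → ℝ) = Matrix.diagonal d * B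

/-- A Kac-Moody root datum `(I, A, Λ, (c i), (h i))`, where `Λ` is a free `ℤ`-module of finite
rank, `c i ∈ Λ`, `h i ∈ Λ^∨` and `⟨c j, h i⟩ = A i j`. -/
structure KacMoodyRootDatum (I Λ : Type*) [AddCommGroup Λ] [Module.Free ℤ Λ]
    [Module.Finite ℤ Λ] where
  A : Matrix I I ℤ
  isGCM : IsGeneralizedCartanMatrix A
  c : I → Λ
  h : I → Module.Dual ℤ Λ
  pairing : ∀ i j, h i (c j) = A i j

/-- A face of a convex set `P`: a non-empty convex subset `F ⊆ P` such that any segment with end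
points in `P` whose relative interior meets `F` lies in `F` (as `F` is convex, it suffices that
the end points lie in `F`, which is what `IsExtreme` says). -/
structure IsConvexFace {V : Type*} [AddCommGroup V] [Module ℝ V] (P F : Set V) : Prop where
  nonempty : F.Nonempty
  convex : Convex ℝ F
  isExtreme : IsExtreme ℝ P F

/-- The face poset of `P`, ordered by inclusion. -/
abbrev FacePoset {V : Type*} [AddCommGroup V] [Module ℝ V] (P : Set V) : Type _ :=
  {F : Set V // IsConvexFace P F}

/-- The dimension of a set: the dimension of its affine span. -/
noncomputable def affineDim {V : Type*} [AddCommGroup V] [Module ℝ V] (F : Set V) : ℕ :=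
  Module.finrank ℝ (affineSpan ℝ F).direction

namespace KacMoodyRootDatum

variable {I Λ : Type*} [AddCommGroup Λ] [Module.Free ℤ Λ] [Module.Finite ℤ Λ]
  (D : KacMoodyRootDatum I Λ)

/-- The root datum is free. -/
def IsFree : Prop := LinearIndependent ℤ D.c

/-- The root datum is cofree. -/
def IsCofree : Prop := LinearIndependent ℤ D.h

/-- The real Cartan subalgebra `𝔞 = Λ^∨ ⊗ ℝ`. -/
abbrev Cartan (_D : KacMoodyRootDatum I Λ) : Type _ := ℝ ⊗[ℤ] Module.Dual ℤ Λ

/-- The simple root `α i`, i.e. `c i` viewed as a linear functional on `𝔞`. -/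
noncomputable def root (i : I) : Module.Dual ℝ D.Cartan :=
  Module.Dual.baseChange ℝ (Module.Dual.eval ℤ Λ (D.c i))

/-- The simple coroot `α i ^∨`, i.e. `h i` viewed as an element of `𝔞`. -/
noncomputable def coroot (i : I) : D.Cartan := (1 : ℝ) ⊗ₜ[ℤ] D.h i

theorem root_coroot (i j : I) : D.root j (D.coroot i) = (D.A i j : ℝ) := by
  simp [root, coroot, D.pairing]

theorem root_coroot_self (i : I) : D.root i (D.coroot i) = 2 := by
  simp [root_coroot, D.isGCM.diag]

/-- The open fundamental chamber `C`. -/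
def openChamber : Set D.Cartan := {x | ∀ i, 0 < D.root i x}

/-- The order of `s i * s j` (for `i ≠ j`) as a function of `a i j * a j i`; the value `0`
stands for `∞`. -/
def orderOfProduct (p : ℤ) : ℕ :=
  if p = 0 then 2 else if p = 1 then 3 else if p = 2 then 4 else if p = 3 then 6 else 0

theorem orderOfProduct_ne_one (p : ℤ) : orderOfProduct p ≠ 1 := by
  unfold orderOfProduct
  split_ifs <;> decide

variable [DecidableEq I]

/-- The Coxeter matrix of the Weyl group. -/
def coxeterMatrix : CoxeterMatrix I where
  M := Matrix.of fun i j => if i = j then 1 else orderOfProduct (D.A i j * D.A j i)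
  isSymm := by
    ext i j
    simp [Matrix.transpose_apply, eq_comm, mul_comm]
  diagonal i := by simp
  off_diagonal i j hij := by simpa [hij] using orderOfProduct_ne_one _

/-- The Weyl group `W`, defined by its Coxeter presentation. -/
abbrev Weyl : Type _ := D.coxeterMatrix.Group

/-- The reflection `x ↦ x - ⟨α i, x⟩ α i ^∨` of `𝔞`. -/
noncomputable def simpleReflection (i : I) : D.Cartan ≃ₗ[ℝ] D.Cartan :=
  Module.reflection (D.root_coroot_self i)

theorem simpleReflection_isLiftable : D.coxeterMatrix.IsLiftable D.simpleReflection := by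
  intro i j
  ext1 z
  by_cases hij : i = j
  · subst hij
    have h1 : D.coxeterMatrix i i = 1 := D.coxeterMatrix.diagonal i
    rw [h1, pow_one]
    exact Module.involutive_reflection (D.root_coroot_self i) z
  · have hm : D.coxeterMatrix i j = orderOfProduct (D.A i j * D.A j i) := by
      simp [coxeterMatrix, hij]
    rw [hm]
    simp only [simpleReflection]
    set a : ℤ := D.A i j with ha
    set b : ℤ := D.A j i with hb
    have hba : D.root i (D.coroot j) = (b : ℝ) := D.root_coroot j i
    have hab : D.root j (D.coroot i) = (a : ℝ) := D.root_coroot i j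
    unfold orderOfProduct
    have key : ∀ p : ℤ, a * b = p → D.root i (D.coroot j) * D.root j (D.coroot i) = (p : ℝ) := by
      intro p hp
      rw [hba, hab, ← hp, Int.cast_mul, mul_comm]
    split_ifs with h0 h1 h2 h3
    · have ha0 : a = 0 := by
        rcases mul_eq_zero.mp h0 with h | h
        · exact h
        · exact (D.isGCM.eq_zero_iff i j).mpr h
      have hb0 : b = 0 := (D.isGCM.eq_zero_iff i j).mp ha0
      simp [pow_two, Module.reflection_apply, hba, hab, ha0, hb0, D.root_coroot_self]
      module
    · rw [Module.reflection_mul_reflection_pow_apply _ _ 3 z (-1)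
        (by rw [key _ h1]; norm_num)]
      norm_num
    · rw [Module.reflection_mul_reflection_pow_apply _ _ 4 z 0
        (by rw [key _ h2]; norm_num)]
      norm_num
    · rw [Module.reflection_mul_reflection_pow_apply _ _ 6 z 1
        (by rw [key _ h3]; norm_num)]
      norm_num [Polynomial.Chebyshev.S_two]
    · simp

/-- The linear action of `W` on `𝔞`, in which the generator `s i` acts by `simpleReflection i`. -/
noncomputable def action : D.Weyl →* (D.Cartan ≃ₗ[ℝ] D.Cartan) :=
  D.coxeterMatrix.toCoxeterSystem.lift ⟨D.simpleReflection, D.simpleReflection_isLiftable⟩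

theorem action_simple (i : I) : D.action (D.coxeterMatrix.simple i) = D.simpleReflection i :=
  D.coxeterMatrix.toCoxeterSystem.lift_apply_simple D.simpleReflection_isLiftable i

/-- The standard subgroup `W_J`, generated by the `s j` with `j ∈ J`. -/
def standardSubgroup (J : Finset I) : Subgroup D.Weyl :=
  Subgroup.closure (D.coxeterMatrix.simple '' (J : Set I))

/-- The poset `Σ*(W, S)` of all standard cosets `w W_J` (as subsets of `W`), ordered by
inclusion. -/
abbrev StandardCosets : Type _ :=
  {X : Set D.Weyl // ∃ (w : D.Weyl) (J : Finset I), X = w • (D.standardSubgroup J : Set D.Weyl)}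

/-- `conv(X · x)` for a subset `X` of `W` and a point `x` of `𝔞`. -/
def hull (X : Set D.Weyl) (x : D.Cartan) : Set D.Cartan :=
  convexHull ℝ ((fun u => D.action u x) '' X)

/-- The convex hull `Ξ_x` of the full orbit `W · x`. -/
def Xi (x : D.Cartan) : Set D.Cartan := D.hull Set.univ x

end KacMoodyRootDatum

/-! Write `x` for the base point in the open chamber. If `s i` is not a right descent of `w`, then
`w` sends the `i`-th simple coroot to a nonnegative combination of simple coroots
(`isNonneg_action_coroot`, reduced to rank two). Since `x - w s_i x = (x - w x) + α_i(x) w α_i^∨`,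
induction on length puts the orbit, hence `Ξ`, in the cone of points `x - v` with `v` nonnegative.

By cofreeness this cone is simplicial, so its points differing from `x` by an element of `corootSpan
J` cut out a face of `Ξ`. The orbit points on that face are those of `W_J`
(`mem_standardSubgroup_iff`), and a face of a hull is spanned by the generators it contains, so the
face is `F_J`. Translation by `w` gives all cosets.

Conversely, every face contains an orbit point, which may be moved to `x`. Each edge direction of
the cone is realized in `Ξ` by `s_i x = x - α_i(x) α_i^∨`, so a face through `x` is determined by `J
= {i | s_i x ∈ F}` (`IsExtreme.sub_sum_smul_mem_iff`). -/

/-! ### Rank-two positivity. -/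

/-- The coefficients of the image of a simple coroot `u` under the alternating product of length `k`
of the reflections `u ↦ -u, v ↦ v + b u` and `v ↦ -v, u ↦ u + a v`, the latter acting first. -/
noncomputable def dihedralCoeff (a b : ℝ) : ℕ → ℝ × ℝ
  | 0 => (1, 0)
  | k + 1 =>
    if Even k then
      ((dihedralCoeff a b k).1, a * (dihedralCoeff a b k).1 - (dihedralCoeff a b k).2)
    else
      (b * (dihedralCoeff a b k).2 - (dihedralCoeff a b k).1, (dihedralCoeff a b k).2)

/-- Signs alone do not propagate. For even `k`, `b q ≤ 2 p` and `4 ≤ a b` give `2 q ≤ a p`, so the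
new coefficient `a p - q` is at least `q` and the companion inequality holds again; odd `k` is
symmetric. -/
theorem dihedralCoeff_nonneg_of_four_le {a b : ℝ} (ha : 0 ≤ a) (hb : 0 ≤ b) (hab : 4 ≤ a * b)
    (k : ℕ) : 0 ≤ (dihedralCoeff a b k).1 ∧ 0 ≤ (dihedralCoeff a b k).2 ∧
      if Even k then b * (dihedralCoeff a b k).2 ≤ 2 * (dihedralCoeff a b k).1
      else a * (dihedralCoeff a b k).1 ≤ 2 * (dihedralCoeff a b k).2 := by
  induction k with
  | zero => simp [dihedralCoeff]
  | succ k ih =>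
    obtain ⟨hp, hq, h⟩ := ih
    by_cases hk : Even k
    · have hk' : ¬ Even (k + 1) := by simp [hk, parity_simps]
      rw [if_pos hk] at h
      rw [if_neg hk']
      simp only [dihedralCoeff, if_pos hk]
      generalize (dihedralCoeff a b k).1 = p at *
      generalize (dihedralCoeff a b k).2 = q at *
      have h1 := mul_le_mul_of_nonneg_left h ha
      have h2 := mul_le_mul_of_nonneg_right hab hq
      refine ⟨hp, by nlinarith, by nlinarith⟩
    · have hk' : Even (k + 1) := by simp [hk, parity_simps]
      rw [if_neg hk] at h
      rw [if_pos hk']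
      simp only [dihedralCoeff, if_neg hk]
      generalize (dihedralCoeff a b k).1 = p at *
      generalize (dihedralCoeff a b k).2 = q at *
      have h1 := mul_le_mul_of_nonneg_left h hb
      have h2 := mul_le_mul_of_nonneg_right hab hp
      refine ⟨by nlinarith, hq, by nlinarith⟩

/-- For finite order the list of coefficients is short and explicit. The bound on `k` is sharp: at
`k` equal to the order a coefficient turns negative. -/
theorem dihedralCoeff_nonneg {a b : ℤ} (ha : 0 ≤ a) (hb : 0 ≤ b) {k : ℕ}
    (hk : KacMoodyRootDatum.orderOfProduct (a * b) = 0 ∨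
      k < KacMoodyRootDatum.orderOfProduct (a * b)) :
    0 ≤ (dihedralCoeff a b k).1 ∧ 0 ≤ (dihedralCoeff a b k).2 := by
  have ha' : (0 : ℝ) ≤ a := by exact_mod_cast ha
  have hb' : (0 : ℝ) ≤ b := by exact_mod_cast hb
  have key : ∀ p : ℤ, a * b = p → (a : ℝ) * b = p := fun p hp => by exact_mod_cast hp
  have even_two : Even 2 := by decide
  have even_four : Even 4 := by decide
  have odd_three : ¬ Even 3 := by decide
  unfold KacMoodyRootDatum.orderOfProduct at hk
  split_ifs at hk with h0 h1 h2 h3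
  · have := key _ h0
    replace hk := hk.resolve_left (by decide)
    interval_cases k <;> simp [dihedralCoeff, ha']
  · have := key _ h1
    replace hk := hk.resolve_left (by decide)
    interval_cases k <;> simp [dihedralCoeff, ha']
    push_cast at this
    nlinarith
  · have := key _ h2
    replace hk := hk.resolve_left (by decide)
    interval_cases k <;> simp [dihedralCoeff, ha', even_two] <;> push_cast at * <;>
      (try refine ⟨?_, ?_⟩) <;> nlinarith
  · have := key _ h3
    push_cast at this
    have h3a : (a : ℝ) * (b * a) = 3 * a := by linear_combination (a : ℝ) * this
    have h9a : (a : ℝ) * (b * (a * (b * a))) = 9 * a := by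
      linear_combination (3 * a + a * b * a : ℝ) * this
    replace hk := hk.resolve_left (by decide)
    interval_cases k <;> simp [dihedralCoeff, ha', even_two, even_four, odd_three] <;>
      push_cast at * <;> (try refine ⟨?_, ?_⟩) <;> nlinarith
  · have h4 : 4 ≤ a * b := by
      have := mul_nonneg ha hb
      omega
    have := dihedralCoeff_nonneg_of_four_le ha' hb' (by exact_mod_cast h4) k
    exact ⟨this.1, this.2.1⟩

/-! ### Faces of convex sets. -/

/-- A face of the convex hull of `S` is contained in the convex hull of the points of `S` on it. -/
theorem IsExtreme.subset_convexHull_inter {V : Type*} [AddCommGroup V] [Module ℝ V] {S F : Set V}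
    (hF : IsExtreme ℝ (convexHull ℝ S) F) : F ⊆ convexHull ℝ (S ∩ F) := by
  have h : convexHull ℝ S ⊆ {y | y ∈ convexHull ℝ S ∧ (y ∈ F → y ∈ convexHull ℝ (S ∩ F))} := by
    refine convexHull_min
      (fun y hy => ⟨subset_convexHull ℝ S hy, fun hyF => subset_convexHull ℝ _ ⟨hy, hyF⟩⟩) ?_
    rw [convex_iff_openSegment_subset]
    rintro p ⟨hp, hp'⟩ q ⟨hq, hq'⟩ y hy
    refine ⟨(convex_convexHull ℝ S).openSegment_subset hp hq hy, fun hyF => ?_⟩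
    exact (convex_convexHull ℝ _).openSegment_subset
      (hp' (hF.left_mem_of_mem_openSegment hp hq hyF hy))
      (hq' (hF.right_mem_of_mem_openSegment hp hq hyF hy)) hy
  exact fun y hy => (h (hF.subset hy)).2 hy

/-- The segment from `y` to `p` is prolonged inside `P` beyond `p`, so `p` is interior to a segment
ending at `y`. -/
theorem IsExtreme.mem_of_add_smul_sub_mem {V : Type*} [AddCommGroup V] [Module ℝ V] {P F : Set V}
    (hF : IsExtreme ℝ P F) {p y : V} (hp : p ∈ F) (hy : y ∈ P) {δ : ℝ} (hδ : 0 < δ)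
    (h : p + δ • (p - y) ∈ P) : y ∈ F := by
  refine hF.left_mem_of_mem_openSegment hy h hp ⟨δ / (1 + δ), 1 / (1 + δ), by positivity,
    by positivity, by field_simp; ring, ?_⟩
  match_scalars <;> field_simp
  ring

theorem Convex.sub_sum_smul_mem {V ι : Type*} [AddCommGroup V] [Module ℝ V] [Fintype ι]
    {F : Set V} (hF : Convex ℝ F) {x : V} (hx : x ∈ F) {e : ι → V} {t : ι → ℝ}
    (ht : ∀ i, 0 ≤ t i) (ht1 : ∑ i, t i ≤ 1) (h : ∀ i, 0 < t i → x - e i ∈ F) :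
    x - ∑ i, t i • e i ∈ F := by
  classical
  -- `none` carries the leftover weight at `x`; indices of weight zero get the dummy point `x`.
  have := hF.sum_mem (t := Finset.univ) (w := fun o : Option ι => o.elim (1 - ∑ i, t i) t)
    (z := fun o : Option ι => o.elim x fun i => if 0 < t i then x - e i else x)
    (by rintro (_ | i) - <;> simp [ht, ht1]) (by simp [Fintype.sum_option])
    (by
      rintro (_ | i) -
      · exact hx
      · by_cases hi : 0 < t i
        · simpa [hi] using h i hi
        · simpa [hi] using hx)
  rw [Fintype.sum_option] at this
  convert this using 1
  have h2 : ∀ i, t i • (if 0 < t i then x - e i else x) = t i • x - t i • e i := by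
    intro i
    split_ifs with hi
    · rw [smul_sub]
    · have : t i = 0 := le_antisymm (not_lt.mp hi) (ht i)
      simp [this]
  simp only [Option.elim, h2, Finset.sum_sub_distrib, sub_smul, one_smul, Finset.sum_smul]
  abel

/-- A face `F` of `P` through a point `x` whose tangent cone is generated by the `-e i`, with
`x - e i ∈ P`, is determined by the set of those `i` with `x - e i ∈ F`. -/
theorem IsExtreme.sub_sum_smul_mem_iff {V ι : Type*} [AddCommGroup V] [Module ℝ V] [Fintype ι]
    {P F : Set V} (hP : Convex ℝ P) (hF : IsExtreme ℝ P F) (hFc : Convex ℝ F) {x : V} (hx : x ∈ F)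
    {e : ι → V} (he : ∀ i, x - e i ∈ P) {n : ι → ℝ} (hn : ∀ i, 0 ≤ n i)
    (hy : x - ∑ i, n i • e i ∈ P) :
    x - ∑ i, n i • e i ∈ F ↔ ∀ i, 0 < n i → x - e i ∈ F := by
  classical
  have hN : 0 ≤ ∑ i, n i := Finset.sum_nonneg fun i _ => hn i
  constructor
  · intro hyF i hi
    -- Shrinking towards `x` makes the coefficient sum at most `1 / 2`, leaving room to prolong.
    set ε : ℝ := 1 / (2 * (1 + ∑ i, n i)) with hε
    have hε0 : 0 < ε := by positivity
    have hεN : ε * ∑ i, n i ≤ 1 / 2 := by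
      rw [hε, div_mul_eq_mul_div, div_le_div_iff₀ (by positivity) (by norm_num)]
      linarith
    have hni : n i ≤ ∑ i, n i := Finset.single_le_sum (fun i _ => hn i) (Finset.mem_univ i)
    have hδ : ε * n i ≤ 1 / 2 := (mul_le_mul_of_nonneg_left hni hε0.le).trans hεN
    have hp : x - ∑ k, (ε * n k) • e k ∈ F := by
      have h1 : ε ≤ 1 := by
        rw [hε, div_le_one (by positivity)]
        linarith
      have := hFc hx hyF (a := 1 - ε) (b := ε) (by linarith) hε0.le (by ring)
      convert this using 1
      simp only [mul_smul, ← Finset.smul_sum]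
      module
    -- Moving away from `x - e i` by `δ = ε * n i` lowers the `i`-th coefficient by at most its own
    -- size, so it stays nonnegative.
    refine hF.mem_of_add_smul_sub_mem hp (he i) (mul_pos hε0 hi) ?_
    have := hP.sub_sum_smul_mem (hF.subset hx) (e := e)
      (t := fun k => (1 + ε * n i) * (ε * n k) - if k = i then ε * n i else 0) ?_ ?_
      (fun i _ => he i)
    · convert this using 1
      simp only [sub_smul, mul_smul, Finset.sum_sub_distrib, ite_smul, zero_smul,
        Finset.sum_ite_eq', Finset.mem_univ, if_true, ← Finset.smul_sum]
      module
    · intro k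
      have := hn k
      split_ifs with hk
      · subst hk
        have : 0 ≤ ε * n k := by positivity
        nlinarith
      · have := hn i
        simp only [sub_zero]
        positivity
    · rw [Finset.sum_sub_distrib, ← Finset.mul_sum, ← Finset.mul_sum]
      simp only [Finset.sum_ite_eq', Finset.mem_univ, if_true]
      have : 0 < ε * n i := mul_pos hε0 hi
      nlinarith
  · intro h
    set c : ℝ := (Fintype.card ι : ℝ)
    have hc : 0 ≤ c := Nat.cast_nonneg _
    set ε : ℝ := 1 / (2 * (1 + c)) with hε
    have hε0 : 0 < ε := by positivity
    have hεc : c * ε ≤ 1 / 2 := by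
      rw [hε, mul_one_div, div_le_div_iff₀ (by positivity) (by norm_num)]
      linarith
    have hε1 : ε ≤ 1 := by
      rw [hε, div_le_one (by positivity)]
      linarith
    set δ : ℝ := ε / (1 + ∑ i, n i) with hδ
    have hδ0 : 0 < δ := by positivity
    have hδn : ∀ i, δ * n i ≤ ε := by
      intro i
      have hni : n i ≤ ∑ i, n i := Finset.single_le_sum (fun i _ => hn i) (Finset.mem_univ i)
      rw [hδ, div_mul_eq_mul_div, div_le_iff₀ (by positivity)]
      nlinarith
    have hδ1 : δ ≤ 1 := by
      rw [hδ, div_le_one (by positivity)]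
      linarith
    have hsum : ∑ i, (if 0 < n i then ε else 0) ≤ 1 / 2 := by
      refine le_trans (Finset.sum_le_sum (g := fun _ => ε) fun i _ => ?_) ?_
      · split_ifs <;> linarith
      · simpa using hεc
    -- This point of `F` has the same support as `n`; `δ * n i ≤ ε` allows prolonging past it, away
    -- from the given point.
    have hp : x - ∑ k, (if 0 < n k then ε else 0) • e k ∈ F := by
      refine hFc.sub_sum_smul_mem hx (fun i => ?_) (by linarith) fun i hi => ?_
      · split_ifs <;> linarith
      · by_contra hi'
        rw [if_neg (fun h0 => hi' (h i h0))] at hi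
        exact lt_irrefl _ hi
    refine hF.mem_of_add_smul_sub_mem hp hy hδ0 ?_
    have := hP.sub_sum_smul_mem (hF.subset hx) (e := e)
      (t := fun k => (1 + δ) * (if 0 < n k then ε else 0) - δ * n k) ?_ ?_
      (fun i _ => he i)
    · convert this using 1
      simp only [sub_smul, mul_smul, Finset.sum_sub_distrib, ← Finset.smul_sum]
      module
    · intro k
      have h1 := hδn k
      split_ifs with hk
      · nlinarith
      · have : n k = 0 := le_antisymm (not_lt.mp hk) (hn k)
        simp [this]
    · rw [Finset.sum_sub_distrib, ← Finset.mul_sum, ← Finset.mul_sum]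
      have : 0 ≤ δ * ∑ i, n i := by positivity
      have : 0 ≤ ∑ i, (if 0 < n i then ε else 0) :=
        Finset.sum_nonneg fun i _ => by split_ifs <;> linarith
      nlinarith

/-! ### Simple coroots and the Weyl group action. -/

namespace KacMoodyRootDatum

variable {I Λ : Type*} [AddCommGroup Λ] [Module.Free ℤ Λ] [Module.Finite ℤ Λ]
  (D : KacMoodyRootDatum I Λ)

theorem linearIndependent_coroot (hcofree : D.IsCofree) : LinearIndependent ℝ D.coroot :=
  Module.Flat.linearIndependent_one_tmul hcofree

/-- The span of the simple coroots indexed by `J`. -/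
def corootSpan (J : Finset I) : Submodule ℝ D.Cartan :=
  Submodule.span ℝ (D.coroot '' (J : Set I))

/-- The vector `v` is a linear combination of simple coroots with nonnegative coefficients. -/
def IsNonneg [Fintype I] (v : D.Cartan) : Prop :=
  ∃ n : I → ℝ, (∀ i, 0 ≤ n i) ∧ v = ∑ i, n i • D.coroot i

variable {D}

section Nonneg

variable [Fintype I]

theorem IsNonneg.zero : D.IsNonneg 0 := ⟨0, by simp, by simp⟩

theorem IsNonneg.add {u v : D.Cartan} (hu : D.IsNonneg u) (hv : D.IsNonneg v) :
    D.IsNonneg (u + v) := by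
  obtain ⟨n, hn, rfl⟩ := hu
  obtain ⟨m, hm, rfl⟩ := hv
  exact ⟨n + m, fun i => add_nonneg (hn i) (hm i), by simp [add_smul, Finset.sum_add_distrib]⟩

theorem IsNonneg.smul {v : D.Cartan} (hv : D.IsNonneg v) {r : ℝ} (hr : 0 ≤ r) :
    D.IsNonneg (r • v) := by
  obtain ⟨n, hn, rfl⟩ := hv
  exact ⟨r • n, fun i => mul_nonneg hr (hn i), by simp [mul_smul, Finset.smul_sum]⟩

theorem IsNonneg.coroot [DecidableEq I] (i : I) : D.IsNonneg (D.coroot i) :=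
  ⟨Pi.single i 1, fun j => by
    by_cases h : j = i
    · subst h; simp
    · simp [h], by simp [Pi.single_apply]⟩

theorem sum_smul_coroot_mem_corootSpan_iff (hcofree : D.IsCofree) {J : Finset I} {n : I → ℝ} :
    ∑ i, n i • D.coroot i ∈ D.corootSpan J ↔ ∀ i ∉ J, n i = 0 := by
  classical
  have hli := D.linearIndependent_coroot hcofree
  constructor
  · intro h i hi
    by_contra hni
    have hle : D.corootSpan J ≤ Submodule.span ℝ (D.coroot '' {j | j ≠ i}) :=
      Submodule.span_mono (Set.image_mono fun j hj => by rintro rfl; exact hi hj)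
    refine hli.notMem_span_image (s := {j | j ≠ i}) (x := i) (by simp) ?_
    have h1 := hle h
    rw [← Finset.add_sum_erase _ _ (Finset.mem_univ i)] at h1
    have h2 : ∑ j ∈ Finset.univ.erase i, n j • D.coroot j ∈
        Submodule.span ℝ (D.coroot '' {j | j ≠ i}) :=
      Submodule.sum_mem _ fun j hj => Submodule.smul_mem _ _
        (Submodule.subset_span ⟨j, Finset.ne_of_mem_erase hj, rfl⟩)
    exact (Submodule.smul_mem_iff _ hni).1 ((Submodule.add_mem_iff_left _ h2).1 h1)
  · intro h
    refine Submodule.sum_mem _ fun i _ => ?_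
    by_cases hi : i ∈ J
    · exact Submodule.smul_mem _ _ (Submodule.subset_span ⟨i, hi, rfl⟩)
    · simp [h i hi]

/-- Coordinates outside `J` are nonnegative and add up to zero, so each vanishes: `J` spans a face
of the coroot cone. -/
theorem IsNonneg.left_mem_corootSpan (hcofree : D.IsCofree) {J : Finset I} {u v : D.Cartan}
    (hu : D.IsNonneg u) (hv : D.IsNonneg v) (h : u + v ∈ D.corootSpan J) : u ∈ D.corootSpan J := by
  obtain ⟨n, hn, rfl⟩ := hu
  obtain ⟨m, hm, rfl⟩ := hv
  have h' : ∑ i, (n i + m i) • D.coroot i ∈ D.corootSpan J := by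
    simpa [add_smul, Finset.sum_add_distrib] using h
  rw [sum_smul_coroot_mem_corootSpan_iff hcofree] at h' ⊢
  intro i hi
  linarith [h' i hi, hn i, hm i]

end Nonneg

theorem mem_of_coroot_mem_corootSpan (hcofree : D.IsCofree) {J : Finset I} {i : I}
    (h : D.coroot i ∈ D.corootSpan J) : i ∈ J := by
  by_contra hi
  exact (D.linearIndependent_coroot hcofree).notMem_span_image (s := (J : Set I))
    (by simpa using hi) h

theorem simpleReflection_apply (i : I) (v : D.Cartan) :
    D.simpleReflection i v = v - D.root i v • D.coroot i :=
  Module.reflection_apply _ _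

variable [DecidableEq I]

/-- The Coxeter system of the Weyl group. -/
abbrev cox (D : KacMoodyRootDatum I Λ) : CoxeterSystem D.coxeterMatrix D.Weyl :=
  D.coxeterMatrix.toCoxeterSystem

theorem action_cox_simple (i : I) (v : D.Cartan) :
    D.action (D.cox.simple i) v = v - D.root i v • D.coroot i := by
  rw [← simpleReflection_apply, ← action_simple, CoxeterMatrix.toCoxeterSystem_simple]

theorem action_mul_apply (u w : D.Weyl) (v : D.Cartan) :
    D.action (u * w) v = D.action u (D.action w v) := by
  rw [map_mul]; rfl

theorem action_one_apply (v : D.Cartan) : D.action 1 v = v := by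
  rw [map_one]; rfl

theorem action_inv_apply_apply (u : D.Weyl) (v : D.Cartan) :
    D.action u⁻¹ (D.action u v) = v := by
  rw [← action_mul_apply, inv_mul_cancel, action_one_apply]

theorem action_apply_inv_apply (u : D.Weyl) (v : D.Cartan) :
    D.action u (D.action u⁻¹ v) = v := by
  rw [← action_mul_apply, mul_inv_cancel, action_one_apply]

theorem action_alternatingWord (i t : I) (k : ℕ) :
    D.action (D.cox.wordProd (CoxeterSystem.alternatingWord i t k)) (D.coroot i) =
      (dihedralCoeff (-D.A i t : ℤ) (-D.A t i : ℤ) k).1 • D.coroot i +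
        (dihedralCoeff (-D.A i t : ℤ) (-D.A t i : ℤ) k).2 • D.coroot t := by
  induction k with
  | zero => simp [CoxeterSystem.alternatingWord, dihedralCoeff]
  | succ k ih =>
    rw [CoxeterSystem.alternatingWord_succ', CoxeterSystem.wordProd_cons, action_mul_apply, ih,
      action_cox_simple]
    by_cases hk : Even k
    · simp only [hk, if_true, dihedralCoeff, map_add, map_smul, root_coroot, D.isGCM.diag,
        smul_eq_mul]
      push_cast
      module
    · simp only [hk, if_false, dihedralCoeff, map_add, map_smul, root_coroot, D.isGCM.diag,
        smul_eq_mul]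
      push_cast
      module

theorem coxeterMatrix_apply_of_ne {i j : I} (h : i ≠ j) :
    D.coxeterMatrix i j = orderOfProduct (D.A i j * D.A j i) := by
  simp [coxeterMatrix, h]

theorem action_sub_mem_corootSpan {J : Finset I} {w : D.Weyl} (hw : w ∈ D.standardSubgroup J)
    (v : D.Cartan) : v - D.action w v ∈ D.corootSpan J := by
  induction hw using Subgroup.closure_induction generalizing v with
  | mem w hw =>
    obtain ⟨i, hi, rfl⟩ := hw
    rw [action_simple, simpleReflection_apply, sub_sub_cancel]
    exact Submodule.smul_mem _ _ (Submodule.subset_span ⟨i, hi, rfl⟩)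
  | one => simp
  | mul u w _ _ hu hw =>
    rw [action_mul_apply]
    simpa using Submodule.add_mem _ (hw v) (hu (D.action w v))
  | inv u _ hu =>
    have := Submodule.neg_mem _ (hu (D.action u⁻¹ v))
    rwa [action_apply_inv_apply, neg_sub] at this

theorem weyl_induction {p : D.Weyl → Prop} (one : p 1)
    (mul_simple : ∀ w i, ¬ D.cox.IsRightDescent w i → p w → p (w * D.cox.simple i))
    (w : D.Weyl) : p w := by
  induction hl : D.cox.length w using Nat.strong_induction_on generalizing w with
  | _ l ih =>
  subst hl
  by_cases hw : w = 1
  · rwa [hw]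
  obtain ⟨i, hi⟩ := D.cox.exists_rightDescent_of_ne_one hw
  have h := mul_simple (w * D.cox.simple i) i
    (D.cox.isRightDescent_iff_not_isRightDescent_mul.1 hi) (ih _ hi _ rfl)
  rwa [CoxeterSystem.simple_mul_simple_cancel_right] at h

theorem sub_action_mul_simple (x : D.Cartan) (w : D.Weyl) (i : I) :
    x - D.action (w * D.cox.simple i) x =
      (x - D.action w x) + D.root i x • D.action w (D.coroot i) := by
  rw [action_mul_apply, action_cox_simple, map_sub, map_smul]
  abel

/-! ### Positivity of coroots and of displacements. -/

variable [Fintype I]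

/-- If `ℓ (w s i) > ℓ w`, then `w` maps the simple coroot of `i` to a positive coroot. -/
theorem isNonneg_action_coroot (w : D.Weyl) (i : I) (h : ¬ D.cox.IsRightDescent w i) :
    D.IsNonneg (D.action w (D.coroot i)) := by
  classical
  induction hl : D.cox.length w using Nat.strong_induction_on generalizing w i with
  | _ l ih =>
  subst hl
  by_cases hw1 : w = 1
  · subst hw1
    rw [action_one_apply]
    exact IsNonneg.coroot i
  obtain ⟨t, ht⟩ := D.cox.exists_rightDescent_of_ne_one hw1
  have hit : i ≠ t := by rintro rfl; exact h ht
  rw [D.cox.not_isRightDescent_iff] at h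
  rw [D.cox.isRightDescent_iff] at ht
  -- Split off on the right of `w` the longest alternating word ending in `t`, with lengths adding.
  let P : ℕ → Prop := fun k => ∃ v : D.Weyl,
    w = v * D.cox.wordProd (CoxeterSystem.alternatingWord i t k) ∧ D.cox.length w = D.cox.length v + k
  have hP1 : P 1 := ⟨w * D.cox.simple t, by
    rw [CoxeterSystem.alternatingWord_succ, CoxeterSystem.wordProd_concat]
    simp [CoxeterSystem.alternatingWord, -CoxeterMatrix.toCoxeterSystem_simple], by omega⟩
  have hk1 : 1 ≤ Nat.findGreatest P (D.cox.length w) := Nat.le_findGreatest (by omega) hP1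
  have hPk : P (Nat.findGreatest P (D.cox.length w)) :=
    Nat.findGreatest_spec (m := 1) (by omega) hP1
  have hPs : ¬ P (Nat.findGreatest P (D.cox.length w) + 1) := by
    intro hP
    have hle : Nat.findGreatest P (D.cox.length w) + 1 ≤ D.cox.length w := by
      obtain ⟨v, -, hv⟩ := hP
      omega
    exact Nat.findGreatest_is_greatest (Nat.lt_succ_self _) hle hP
  generalize Nat.findGreatest P (D.cox.length w) = k at hk1 hPk hPs
  obtain ⟨k, rfl⟩ : ∃ k', k = k' + 1 := ⟨k - 1, by omega⟩
  obtain ⟨v, hwv, hlv⟩ := hPk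
  -- A descent at the word's first letter would make `w` too short; one at the other letter (`hb`)
  -- would lengthen the word, against maximality.
  have ha : ¬ D.cox.IsRightDescent v (if Even k then t else i) := by
    intro hd
    rw [D.cox.isRightDescent_iff] at hd
    have h1 : w = v * D.cox.simple (if Even k then t else i) *
        D.cox.wordProd (CoxeterSystem.alternatingWord i t k) := by
      rw [hwv, CoxeterSystem.alternatingWord_succ', CoxeterSystem.wordProd_cons, mul_assoc]
    have h2 := D.cox.length_mul_le (v * D.cox.simple (if Even k then t else i))
      (D.cox.wordProd (CoxeterSystem.alternatingWord i t k))
    have h3 := D.cox.length_wordProd_le (CoxeterSystem.alternatingWord i t k)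
    rw [← h1] at h2
    rw [CoxeterSystem.length_alternatingWord] at h3
    omega
  have hb : ¬ D.cox.IsRightDescent v (if Even (k + 1) then t else i) := by
    intro hd
    rw [D.cox.isRightDescent_iff] at hd
    refine hPs ⟨v * D.cox.simple (if Even (k + 1) then t else i), ?_, by omega⟩
    rw [CoxeterSystem.alternatingWord_succ', CoxeterSystem.wordProd_cons, ← mul_assoc,
      CoxeterSystem.simple_mul_simple_cancel_right, hwv]
  have hvit : D.IsNonneg (D.action v (D.coroot i)) ∧ D.IsNonneg (D.action v (D.coroot t)) := by
    have ha' := ih _ (by omega) v _ ha rfl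
    have hb' := ih _ (by omega) v _ hb rfl
    by_cases hk : Even k
    · have hk' : ¬ Even (k + 1) := by simp [hk, parity_simps]
      rw [if_pos hk] at ha'
      rw [if_neg hk'] at hb'
      exact ⟨hb', ha'⟩
    · have hk' : Even (k + 1) := by simp [hk, parity_simps]
      rw [if_neg hk] at ha'
      rw [if_pos hk'] at hb'
      exact ⟨ha', hb'⟩
  have hred : D.cox.IsReduced (CoxeterSystem.alternatingWord i t (k + 1)) := by
    have h2 := D.cox.length_mul_le v (D.cox.wordProd (CoxeterSystem.alternatingWord i t (k + 1)))
    have h3 := D.cox.length_wordProd_le (CoxeterSystem.alternatingWord i t (k + 1))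
    rw [← hwv] at h2
    rw [CoxeterSystem.length_alternatingWord] at h3
    rw [CoxeterSystem.IsReduced, CoxeterSystem.length_alternatingWord]
    omega
  -- Beyond the order the word is not reduced; at the order, the braid relation makes it end in `i`,
  -- a right descent of `w`, against `h`.
  have hkm : D.coxeterMatrix i t = 0 ∨ k + 1 < D.coxeterMatrix i t := by
    by_contra! hcon
    obtain ⟨hm0, hm⟩ := hcon
    rcases hm.lt_or_eq with hm | hm
    · exact D.cox.not_isReduced_alternatingWord i t hm0 hm hred
    · have hbr := D.cox.wordProd_braidWord_eq i t
      simp only [CoxeterSystem.braidWord] at hbr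
      rw [D.coxeterMatrix.symmetric t i, hm, CoxeterSystem.alternatingWord_succ t i,
        CoxeterSystem.wordProd_concat] at hbr
      have h1 : w * D.cox.simple i =
          v * D.cox.wordProd (CoxeterSystem.alternatingWord i t k) := by
        rw [hwv, hbr, mul_assoc, CoxeterSystem.simple_mul_simple_cancel_right]
      have h2 := D.cox.length_mul_le v (D.cox.wordProd (CoxeterSystem.alternatingWord i t k))
      have h3 := D.cox.length_wordProd_le (CoxeterSystem.alternatingWord i t k)
      rw [← h1] at h2
      rw [CoxeterSystem.length_alternatingWord] at h3
      omega
  rw [coxeterMatrix_apply_of_ne hit, ← neg_mul_neg] at hkm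
  obtain ⟨hp, hq⟩ := dihedralCoeff_nonneg
    (neg_nonneg.2 (D.isGCM.offDiag_nonpos i t hit))
    (neg_nonneg.2 (D.isGCM.offDiag_nonpos t i hit.symm)) hkm
  rw [hwv, action_mul_apply, action_alternatingWord, map_add, map_smul, map_smul]
  exact (hvit.1.smul hp).add (hvit.2.smul hq)

variable {x : D.Cartan}

theorem isNonneg_sub_action (hx : x ∈ D.openChamber) (w : D.Weyl) :
    D.IsNonneg (x - D.action w x) := by
  induction w using weyl_induction with
  | one => simpa [action_one_apply] using IsNonneg.zero
  | mul_simple w i hi ih =>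
    rw [sub_action_mul_simple]
    exact ih.add ((isNonneg_action_coroot w i hi).smul (hx i).le)

/-- In the inductive step both nonnegative summands lie in the span. Hence `w ∈ W_J`, which moves
vectors only within the span, so the coroot of `i` lies there too and `i ∈ J`. The case `J = ∅` says
that the orbit is free. -/
theorem mem_standardSubgroup_iff (hcofree : D.IsCofree) (hx : x ∈ D.openChamber) {J : Finset I}
    {w : D.Weyl} : w ∈ D.standardSubgroup J ↔ x - D.action w x ∈ D.corootSpan J := by
  refine ⟨fun hw => action_sub_mem_corootSpan hw x, fun h => ?_⟩
  induction w using weyl_induction with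
  | one => exact one_mem _
  | mul_simple w i hi ih =>
    rw [sub_action_mul_simple] at h
    have h1 := isNonneg_sub_action hx w
    have h2 := (isNonneg_action_coroot w i hi).smul (hx i).le
    have hw := ih (h1.left_mem_corootSpan hcofree h2 h)
    rw [add_comm] at h
    have h3 := h2.left_mem_corootSpan hcofree h1 h
    have h4 := (Submodule.smul_mem_iff _ (hx i).ne').1 h3
    have h5 : D.coroot i ∈ D.corootSpan J := by
      simpa using Submodule.add_mem _ (action_sub_mem_corootSpan hw (D.coroot i)) h4
    refine mul_mem hw (Subgroup.subset_closure ⟨i, mem_of_coroot_mem_corootSpan hcofree h5, ?_⟩)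
    rw [CoxeterMatrix.toCoxeterSystem_simple]

end KacMoodyRootDatum

/-! ### Linear transport and dimension. -/

theorem IsConvexFace.image {V W : Type*} [AddCommGroup V] [Module ℝ V] [AddCommGroup W]
    [Module ℝ W] {P F : Set V} (hF : IsConvexFace P F) (f : V ≃ₗ[ℝ] W) :
    IsConvexFace (f '' P) (f '' F) where
  nonempty := hF.nonempty.image f
  convex := hF.convex.linear_image f.toLinearMap
  isExtreme := by
    refine ⟨Set.image_mono hF.isExtreme.subset, ?_⟩
    rintro _ ⟨p, hp, rfl⟩ _ ⟨q, hq, rfl⟩ _ ⟨z, hz, rfl⟩ ⟨a, b, ha, hb, hab, h⟩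
    refine ⟨p, hF.isExtreme.left_mem_of_mem_openSegment hp hq hz ⟨a, b, ha, hb, hab, ?_⟩, rfl⟩
    exact f.injective (by simpa using h)

theorem affineDim_image {V W : Type*} [AddCommGroup V] [Module ℝ V] [AddCommGroup W]
    [Module ℝ W] (f : V ≃ₗ[ℝ] W) (F : Set V) : affineDim (f '' F) = affineDim F := by
  have h := (f : V →ₗ[ℝ] W).toAffineMap.map_vectorSpan (s := F)
  unfold affineDim
  rw [direction_affineSpan, direction_affineSpan]
  have h' : vectorSpan ℝ (f '' F) = (vectorSpan ℝ F).map (f : V →ₗ[ℝ] W) := h.symm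
  rw [h']
  exact LinearEquiv.finrank_map_eq f _

namespace KacMoodyRootDatum

variable {I Λ : Type*} [AddCommGroup Λ] [Module.Free ℤ Λ] [Module.Finite ℤ Λ]
  {D : KacMoodyRootDatum I Λ}

theorem finrank_corootSpan (hcofree : D.IsCofree) (J : Finset I) :
    Module.finrank ℝ (D.corootSpan J) = J.card := by
  have h := finrank_span_eq_card (R := ℝ) (b := fun j : J => D.coroot j)
    ((D.linearIndependent_coroot hcofree).comp _ Subtype.val_injective)
  have h2 : Set.range (fun j : J => D.coroot j) = D.coroot '' (J : Set I) := by
    ext v; simp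
  rw [h2, Fintype.card_coe] at h
  exact h

variable [DecidableEq I] {x : D.Cartan}

theorem convex_hull (X : Set D.Weyl) (x : D.Cartan) : Convex ℝ (D.hull X x) :=
  convex_convexHull ℝ _

theorem action_mem_hull {X : Set D.Weyl} {u : D.Weyl} (hu : u ∈ X) :
    D.action u x ∈ D.hull X x :=
  subset_convexHull ℝ _ ⟨u, hu, rfl⟩

theorem hull_mono {X Y : Set D.Weyl} (h : X ⊆ Y) : D.hull X x ⊆ D.hull Y x :=
  convexHull_mono (Set.image_mono h)

theorem action_image_hull (w : D.Weyl) (X : Set D.Weyl) (x : D.Cartan) :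
    D.action w '' D.hull X x = D.hull (w • X) x := by
  have h := (D.action w : D.Cartan →ₗ[ℝ] D.Cartan).image_convexHull
    ((fun u => D.action u x) '' X)
  have h2 : D.action w '' ((fun u => D.action u x) '' X) = (fun u => D.action u x) '' (w • X) := by
    rw [← Set.image_smul, Set.image_image, Set.image_image]
    simp only [smul_eq_mul, action_mul_apply]
  unfold hull
  rw [← h2]
  exact h

theorem action_image_Xi (w : D.Weyl) (x : D.Cartan) : D.action w '' D.Xi x = D.Xi x := by
  rw [Xi, action_image_hull, Set.smul_set_univ]

theorem sub_mem_corootSpan_of_mem_hull {J : Finset I} {y : D.Cartan}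
    (hy : y ∈ D.hull (D.standardSubgroup J) x) : x - y ∈ D.corootSpan J := by
  have hc : Convex ℝ {y | x - y ∈ D.corootSpan J} := by
    intro p hp q hq a b _ _ hab
    have h : x - (a • p + b • q) = a • (x - p) + b • (x - q) := by
      obtain rfl : b = 1 - a := by linarith
      module
    simp only [Set.mem_ofPred_eq, h] at hp hq ⊢
    exact Submodule.add_mem _ (Submodule.smul_mem _ _ hp) (Submodule.smul_mem _ _ hq)
  refine convexHull_min ?_ hc hy
  rintro _ ⟨u, hu, rfl⟩
  exact action_sub_mem_corootSpan hu x

/-- The differences `x - s_j x` are nonzero multiples of the simple coroots of `J`. -/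
theorem affineDim_hull_standardSubgroup (hcofree : D.IsCofree) (hx : x ∈ D.openChamber)
    (J : Finset I) : affineDim (D.hull (D.standardSubgroup J) x) = J.card := by
  unfold affineDim
  rw [← finrank_corootSpan hcofree J, direction_affineSpan]
  suffices h : vectorSpan ℝ (D.hull (D.standardSubgroup J) x) = D.corootSpan J by rw [h]
  refine le_antisymm ?_ ?_
  · rw [vectorSpan_def, Submodule.span_le]
    rintro _ ⟨p, hp, q, hq, rfl⟩
    simpa using Submodule.sub_mem _ (sub_mem_corootSpan_of_mem_hull hq)
      (sub_mem_corootSpan_of_mem_hull hp)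
  · rw [corootSpan, Submodule.span_le]
    rintro _ ⟨j, hj, rfl⟩
    have h1 : D.action 1 x ∈ D.hull (D.standardSubgroup J) x := action_mem_hull (one_mem _)
    have h2 : D.action (D.coxeterMatrix.simple j) x ∈ D.hull (D.standardSubgroup J) x :=
      action_mem_hull (Subgroup.subset_closure ⟨j, hj, rfl⟩)
    have h := vsub_mem_vectorSpan ℝ h1 h2
    rw [action_one_apply, action_simple, simpleReflection_apply, vsub_eq_sub, sub_sub_cancel] at h
    exact (Submodule.smul_mem_iff _ (hx j).ne').1 h

/-! ### Classification of the faces. -/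

variable [Fintype I]

theorem isNonneg_sub_of_mem_Xi (hx : x ∈ D.openChamber) {y : D.Cartan} (hy : y ∈ D.Xi x) :
    D.IsNonneg (x - y) := by
  have hc : Convex ℝ {y | D.IsNonneg (x - y)} := by
    intro p hp q hq a b ha hb hab
    have h : x - (a • p + b • q) = a • (x - p) + b • (x - q) := by
      obtain rfl : b = 1 - a := by linarith
      module
    simp only [Set.mem_ofPred_eq, h] at hp hq ⊢
    exact (hp.smul ha).add (hq.smul hb)
  refine convexHull_min ?_ hc hy
  rintro _ ⟨u, -, rfl⟩
  exact isNonneg_sub_action hx u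

theorem isExtreme_sub_mem_corootSpan (hcofree : D.IsCofree) (hx : x ∈ D.openChamber)
    (J : Finset I) : IsExtreme ℝ (D.Xi x) {y | y ∈ D.Xi x ∧ x - y ∈ D.corootSpan J} := by
  refine ⟨fun y hy => hy.1, ?_⟩
  rintro p hp q hq _ ⟨-, hz⟩ ⟨a, b, ha, hb, hab, rfl⟩
  refine ⟨hp, (Submodule.smul_mem_iff _ ha.ne').1
    (((isNonneg_sub_of_mem_Xi hx hp).smul ha.le).left_mem_corootSpan hcofree
      ((isNonneg_sub_of_mem_Xi hx hq).smul hb.le) ?_)⟩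
  convert hz using 1
  obtain rfl : b = 1 - a := by linarith
  module

/-- The right-hand side is extreme, hence spanned by its orbit points, and these belong to `W_J`. -/
theorem hull_standardSubgroup_eq (hcofree : D.IsCofree) (hx : x ∈ D.openChamber) (J : Finset I) :
    D.hull (D.standardSubgroup J) x = {y | y ∈ D.Xi x ∧ x - y ∈ D.corootSpan J} := by
  refine Set.Subset.antisymm
    (fun y hy => ⟨hull_mono (Set.subset_univ _) hy, sub_mem_corootSpan_of_mem_hull hy⟩) ?_
  refine (isExtreme_sub_mem_corootSpan hcofree hx J).subset_convexHull_inter.trans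
    (convexHull_mono ?_)
  rintro _ ⟨⟨u, -, rfl⟩, -, hu⟩
  exact ⟨u, (mem_standardSubgroup_iff hcofree hx).2 hu, rfl⟩

theorem isConvexFace_hull_standardSubgroup (hcofree : D.IsCofree) (hx : x ∈ D.openChamber)
    (J : Finset I) : IsConvexFace (D.Xi x) (D.hull (D.standardSubgroup J) x) where
  nonempty := ⟨_, action_mem_hull (one_mem _)⟩
  convex := convex_hull _ _
  isExtreme := by
    rw [hull_standardSubgroup_eq hcofree hx]
    exact isExtreme_sub_mem_corootSpan hcofree hx J

theorem isConvexFace_hull (hcofree : D.IsCofree) (hx : x ∈ D.openChamber)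
    (w : D.Weyl) (J : Finset I) :
    IsConvexFace (D.Xi x) (D.hull (w • (D.standardSubgroup J : Set D.Weyl)) x) := by
  rw [← action_image_hull, ← action_image_Xi w]
  exact (isConvexFace_hull_standardSubgroup hcofree hx J).image (D.action w)

/-- A coset is recovered from its hull, which yields uniqueness and order reflection. -/
theorem action_mem_hull_iff (hcofree : D.IsCofree) (hx : x ∈ D.openChamber)
    (X : D.StandardCosets) {u : D.Weyl} : D.action u x ∈ D.hull X x ↔ u ∈ (X : Set D.Weyl) := by
  refine ⟨fun hu => ?_, action_mem_hull⟩
  obtain ⟨X, w, J, rfl⟩ := X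
  simp only [← action_image_hull] at hu
  obtain ⟨y, hy, hyu⟩ := hu
  have h : y = D.action (w⁻¹ * u) x := by
    rw [action_mul_apply, ← hyu, action_inv_apply_apply]
  rw [h] at hy
  rw [Set.mem_smul_set_iff_inv_smul_mem]
  exact (mem_standardSubgroup_iff hcofree hx).2 (sub_mem_corootSpan_of_mem_hull hy)

theorem hull_subset_hull_iff (hcofree : D.IsCofree) (hx : x ∈ D.openChamber)
    {X Y : D.StandardCosets} : D.hull X x ⊆ D.hull Y x ↔ X ≤ Y :=
  ⟨fun h _ hu => (action_mem_hull_iff hcofree hx Y).1 (h (action_mem_hull hu)),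
    fun h => hull_mono h⟩

/-- A face containing the base point of the orbit is the hull of the orbit of a standard
subgroup. -/
theorem exists_eq_hull_standardSubgroup (hcofree : D.IsCofree) (hx : x ∈ D.openChamber)
    {F : Set D.Cartan} (hF : IsConvexFace (D.Xi x) F) (hxF : x ∈ F) :
    ∃ J : Finset I, F = D.hull (D.standardSubgroup J) x := by
  classical
  let J : Finset I := Finset.univ.filter fun i => x - D.root i x • D.coroot i ∈ F
  have key : ∀ u, D.action u x ∈ F ↔ u ∈ D.standardSubgroup J := by
    intro u
    obtain ⟨n, hn, hu⟩ := isNonneg_sub_action hx u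
    -- Coroots are rescaled so that subtracting the `i`-th generator from `x` gives `s_i x`, a point
    -- of `Ξ`.
    have hsum : ∑ i, n i • D.coroot i =
        ∑ i, (n i / D.root i x) • (D.root i x • D.coroot i) :=
      Finset.sum_congr rfl fun i _ => by rw [smul_smul, div_mul_cancel₀ _ (hx i).ne']
    have hux : D.action u x = x - ∑ i, (n i / D.root i x) • (D.root i x • D.coroot i) := by
      rw [← hsum, ← hu, sub_sub_cancel]
    have hmem : D.action u x ∈ D.Xi x := action_mem_hull (Set.mem_univ u)
    rw [mem_standardSubgroup_iff hcofree hx, hu, sum_smul_coroot_mem_corootSpan_iff hcofree, hux,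
      hF.isExtreme.sub_sum_smul_mem_iff (convex_hull _ _) hF.convex hxF
        (fun i => by
          rw [← simpleReflection_apply, ← action_simple]
          exact action_mem_hull (Set.mem_univ _))
        (fun i => div_nonneg (hn i) (hx i).le) (hux ▸ hmem)]
    refine forall_congr' fun i => ?_
    have hi : 0 < n i / D.root i x ↔ n i ≠ 0 := by
      rw [div_pos_iff_of_pos_right (hx i)]
      exact (hn i).lt_iff_ne'
    simp only [hi, J, Finset.mem_filter, Finset.mem_univ, true_and]
    tauto
  refine ⟨J, Set.Subset.antisymm ?_ (convexHull_min ?_ hF.convex)⟩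
  · refine (IsExtreme.subset_convexHull_inter hF.isExtreme).trans (convexHull_mono ?_)
    rintro _ ⟨⟨u, -, rfl⟩, hu⟩
    exact ⟨u, (key u).1 hu, rfl⟩
  · rintro _ ⟨u, hu, rfl⟩
    exact (key u).2 hu

theorem exists_eq_hull (hcofree : D.IsCofree) (hx : x ∈ D.openChamber)
    {F : Set D.Cartan} (hF : IsConvexFace (D.Xi x) F) : ∃ X : D.StandardCosets, F = D.hull X x := by
  obtain ⟨_, ⟨w, -, rfl⟩, hw⟩ := convexHull_nonempty_iff.1
    (hF.nonempty.mono (IsExtreme.subset_convexHull_inter hF.isExtreme))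
  have hF' := hF.image (D.action w⁻¹)
  rw [action_image_Xi] at hF'
  obtain ⟨J, hJ⟩ := exists_eq_hull_standardSubgroup hcofree hx hF'
    ⟨_, hw, action_inv_apply_apply w x⟩
  refine ⟨⟨_, w, J, rfl⟩, ?_⟩
  rw [← action_image_hull, ← hJ, Set.image_image]
  simp

end KacMoodyRootDatum

theorem mainTheorem4 {I Λ : Type*} [Fintype I] [DecidableEq I]
    [AddCommGroup Λ] [Module.Free ℤ Λ] [Module.Finite ℤ Λ]
    (D : KacMoodyRootDatum I Λ) (hsymm : IsSymmetrizable D.A)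
    (hfree : D.IsFree) (hcofree : D.IsCofree)
    (x : D.Cartan) (hx : x ∈ D.openChamber) :
    (∀ (w : D.Weyl) (J : Finset I),
      D.action w '' D.hull (D.standardSubgroup J) x
          = D.hull (w • (D.standardSubgroup J : Set D.Weyl)) x ∧
        IsConvexFace (D.Xi x) (D.hull (w • (D.standardSubgroup J : Set D.Weyl)) x) ∧
        affineDim (D.hull (w • (D.standardSubgroup J : Set D.Weyl)) x) = J.card) ∧
    (∀ F : Set D.Cartan, IsConvexFace (D.Xi x) F →
      ∃! X : D.StandardCosets, F = D.hull X x) ∧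
    (∃ e : D.StandardCosets ≃o FacePoset (D.Xi x),
      ∀ X : D.StandardCosets, (e X : Set D.Cartan) = D.hull X x) := by
  have hinj : ∀ X Y : D.StandardCosets, D.hull X x = D.hull Y x → X = Y := fun X Y h =>
    le_antisymm ((KacMoodyRootDatum.hull_subset_hull_iff hcofree hx).1 h.subset)
      ((KacMoodyRootDatum.hull_subset_hull_iff hcofree hx).1 h.symm.subset)
  have hface : ∀ X : D.StandardCosets, IsConvexFace (D.Xi x) (D.hull X x) := by
    rintro ⟨_, w, J, rfl⟩
    exact KacMoodyRootDatum.isConvexFace_hull hcofree hx w J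
  refine ⟨fun w J => ⟨KacMoodyRootDatum.action_image_hull w _ x,
    KacMoodyRootDatum.isConvexFace_hull hcofree hx w J, ?_⟩, fun F hF => ?_, ?_⟩
  · rw [← KacMoodyRootDatum.action_image_hull, affineDim_image]
    exact KacMoodyRootDatum.affineDim_hull_standardSubgroup hcofree hx J
  · obtain ⟨X, hX⟩ := KacMoodyRootDatum.exists_eq_hull hcofree hx hF
    exact ⟨X, hX, fun Y hY => hinj _ _ (hY.symm.trans hX)⟩
  · let f : D.StandardCosets ↪o FacePoset (D.Xi x) :=
      OrderEmbedding.ofMapLEIff (fun X => ⟨D.hull X x, hface X⟩)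
        fun _ _ => KacMoodyRootDatum.hull_subset_hull_iff hcofree hx
    refine ⟨RelIso.ofSurjective f ?_, fun X => rfl⟩
    rintro ⟨F, hF⟩
    obtain ⟨X, hX⟩ := KacMoodyRootDatum.exists_eq_hull hcofree hx hF
    exact ⟨X, Subtype.ext hX.symm⟩
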